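/- For integers $n\ge 1$ and $k\ge 2$, let $\mathcal C_n$ be the directed cycle with vertices $v_i$ and edges $e_i$ from $v_i$ to $v_{i+1}$ ($i\in\mathbb Z/n$; for $n=1$ this is a single loop). Let $A=C^*(\mathcal C_n)$ be its graph $C^*$-algebra: the universal $C^*$-algebra generated by mutually orthogonal projections $P_{v_i}$ and partial isometries $S_{e_i}$ with mutually orthogonal ranges such that $S_{e_i}^*S_{e_i}=P_{v_{i+1}}$ and $S_{e_i}S_{e_i}^*=P_{v_i}$ for all $i$. It is unital, with unit $\sum_i P_{v_i}$. The gauge action of $G=\mathbb Z/k$ on $A$ is the action in which the class of $j$ acts by $P_{v_i}\mapsto P_{v_i}$, $S_{e_i}\mapsto e^{2\pi \mathrm i j/k}S_{e_i}$. For an action of a compact group $G$ on a unital $C^*$-algebra $A$, let $G$ act on $C(G)$ by $(g\cdot f)(h)=f(hg)$ and trivially on $C_0((0,1])$, and let $t$ be the identity function in $C_0((0,1])$. - The local-triviality dimension is the least $m$ for which there are $G$-equivariant $*$-homomorphisms $\rho_0,\dots,\rho_m: C_0((0,1])\otimes C(G)\to A$ with $\sum_{i=0}^m\rho_i(t\otimes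 1)=1$. - The weak local-triviality dimension is the least $m$ for which there are such $\rho_0,\dots,\rho_m$ with $\sum_{i=0}^m\rho_i(t\otimes 1)$ invertible. - The strong local-triviality dimension is the least $m$ for which there is a $G$-equivariant unital $*$-homomorphism $C(E_mG)\to A$, where $E_0G=G$ and $E_{m+1}G=E_mG*G$ (topological join) with the diagonal action by right translation and $(g\cdot f)(x)=f(xg)$ for $f\in C(E_mG)$. In each case the dimension is $\infty$ if there is no such $m$. Then, for the gauge action of $\mathbb Z/k$ on $C^*(\mathcal C_n)$: if $k\mid n$, then the weak, plain and strong local-triviality dimensions are all equal to $0$; if $k\nmid n$, then they are all equal to $1$. -/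

import Mathlib

open Topology
open scoped ENNReal ZeroAtInfty

noncomputable section

/-! ## Graph C*-algebras -/

/-- A directed graph with vertices `V`, edges `Ed`, source map `s` and range map `r`.
Loops and multiple edges are allowed. -/
structure DirectedGraph (V Ed : Type) where
  /-- source map -/
  s : Ed → V
  /-- range map -/
  r : Ed → V

/-- The cycle with `n` vertices `v_i` and `n` edges `e_i : v_i ⟶ v_{i+1}`, indices modulo `n`
(a single loop when `n = 1`). -/
def cycleGraph (n : ℕ) [NeZero n] : DirectedGraph (Fin n) (Fin n) where
  s := fun i => i
  r := fun i => i + 1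

/-- Elements `P v`, `S e` of a C*-algebra `B` that satisfy the relations defining the graph
C*-algebra of `E`. -/
structure CuntzKriegerFamily {V Ed : Type} (E : DirectedGraph V Ed)
    (B : Type*) [NonUnitalCStarAlgebra B] where
  /-- vertex projections -/
  P : V → B
  /-- edge partial isometries -/
  S : Ed → B
  isProj : ∀ v, IsStarProjection (P v)
  orthogonal : ∀ v w, v ≠ w → P v * P w = 0
  partialIsometry : ∀ e, S e * star (S e) * S e = S e
  orthogonal_ranges : ∀ e f, e ≠ f → (S e * star (S e)) * (S f * star (S f)) = 0
  star_S_mul_S : ∀ e, star (S e) * S e = P (E.r e)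
  /-- `S e * star (S e) ≤ P (s e)`; for projections, `q ≤ p` means `p * q = q`. -/
  range_le : ∀ e, P (E.s e) * (S e * star (S e)) = S e * star (S e)
  sum_ranges : ∀ (v : V) (h : (E.s ⁻¹' {v}).Finite), (E.s ⁻¹' {v}).Nonempty →
    P v = ∑ e ∈ h.toFinset, S e * star (S e)

namespace CuntzKriegerFamily

variable {V Ed : Type} {E : DirectedGraph V Ed} {B : Type*} [NonUnitalCStarAlgebra B]

theorem norm_P_le (F : CuntzKriegerFamily E B) (v : V) : ‖F.P v‖ ≤ 1 :=
  (F.isProj v).norm_le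

theorem norm_S_le (F : CuntzKriegerFamily E B) (e : Ed) : ‖F.S e‖ ≤ 1 := by
  have h1 : ‖F.S e‖ * ‖F.S e‖ ≤ 1 := by
    rw [← CStarRing.norm_star_mul_self, F.star_S_mul_S]
    exact F.norm_P_le _
  nlinarith [norm_nonneg (F.S e)]

theorem P_mul_S (F : CuntzKriegerFamily E B) (e : Ed) : F.P (E.s e) * F.S e = F.S e := by
  rw [← F.partialIsometry e, ← mul_assoc, F.range_le]

theorem S_mul_P (F : CuntzKriegerFamily E B) (e : Ed) : F.S e * F.P (E.r e) = F.S e := by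
  rw [← F.star_S_mul_S, ← mul_assoc, F.partialIsometry]

/-- Multiplying every `S e` by the unit complex number `z` gives another family. -/
def rotate (z : Circle) (F : CuntzKriegerFamily E B) : CuntzKriegerFamily E B :=
  have hz : (z : ℂ) * star (z : ℂ) = 1 := by simp [Complex.mul_conj]
  have hz' : star (z : ℂ) * (z : ℂ) = 1 := by rw [mul_comm, hz]
  have h1 : ∀ a b : B, ((z : ℂ) • a) * star ((z : ℂ) • b) = a * star b := fun a b => by
    rw [star_smul, smul_mul_smul_comm, hz, one_smul]
  { P := F.P
    S := fun e => (z : ℂ) • F.S e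
    isProj := F.isProj
    orthogonal := F.orthogonal
    partialIsometry := fun e => by rw [h1, mul_smul_comm, F.partialIsometry]
    orthogonal_ranges := fun e f hef => by rw [h1, h1, F.orthogonal_ranges e f hef]
    star_S_mul_S := fun e => by
      rw [star_smul, smul_mul_smul_comm, hz', one_smul, F.star_S_mul_S]
    range_le := fun e => by rw [h1, F.range_le]
    sum_ranges := fun v h hne => by
      rw [F.sum_ranges v h hne]
      exact Finset.sum_congr rfl fun e _ => (h1 _ _).symm }

theorem rotate_one (F : CuntzKriegerFamily E B) : F.rotate 1 = F := by
  cases F; simp [rotate]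

theorem rotate_rotate (z w : Circle) (F : CuntzKriegerFamily E B) :
    (F.rotate w).rotate z = F.rotate (z * w) := by
  cases F; simp [rotate, mul_smul]

end CuntzKriegerFamily

/-- A C*-algebra together with a family satisfying the relations of `E`. -/
structure CuntzKriegerRep {V Ed : Type} (E : DirectedGraph V Ed) : Type 1 where
  /-- the target algebra -/
  alg : Type
  [inst : NonUnitalCStarAlgebra alg]
  /-- the family -/
  fam : CuntzKriegerFamily E alg

attribute [instance] CuntzKriegerRep.inst

namespace GraphCStar

variable {V Ed : Type} (E : DirectedGraph V Ed)

/-- The C*-algebra of bounded families indexed by all representations of the relations of `E`. -/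
abbrev Ambient : Type 1 := lp (fun R : CuntzKriegerRep E => R.alg) ∞

/-- The vertex projections of all representations at once. -/
def ambientP (v : V) : Ambient E :=
  ⟨fun R => R.fam.P v, memℓp_infty ⟨1, by rintro _ ⟨R, rfl⟩; exact R.fam.norm_P_le v⟩⟩

/-- The edge partial isometries of all representations at once. -/
def ambientS (e : Ed) : Ambient E :=
  ⟨fun R => R.fam.S e, memℓp_infty ⟨1, by rintro _ ⟨R, rfl⟩; exact R.fam.norm_S_le e⟩⟩

/-- The closed `*`-subalgebra generated by the `ambientP v` and `ambientS e`. -/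
def subalgebra : NonUnitalStarSubalgebra ℂ (Ambient E) :=
  (NonUnitalStarAlgebra.adjoin ℂ
    (Set.range (ambientP E) ∪ Set.range (ambientS E))).topologicalClosure

instance isClosed_subalgebra : IsClosed (subalgebra E : Set (Ambient E)) :=
  NonUnitalStarSubalgebra.isClosed_topologicalClosure _

end GraphCStar

/-- The graph C*-algebra `C*(E)`: the universal C*-algebra generated by elements `P v`, `S e`
subject to the relations of `CuntzKriegerFamily`, realised as the closed `*`-subalgebra generated
by the tautological family in the product of all representations. (A C*-algebra generated by a
family on `V` and `Ed` is isomorphic to one with underlying set in `Type`, so restricting the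
product to those loses nothing.) -/
def GraphCStar {V Ed : Type} (E : DirectedGraph V Ed) : Type 1 := GraphCStar.subalgebra E

namespace GraphCStar

variable {V Ed : Type} {E : DirectedGraph V Ed}

instance instNonUnitalCStarAlgebra : NonUnitalCStarAlgebra (GraphCStar E) :=
  NonUnitalStarSubalgebra.nonUnitalCStarAlgebra (subalgebra E)
    (h_closed := isClosed_subalgebra E)

theorem ambientP_mem (v : V) : ambientP E v ∈ subalgebra E :=
  NonUnitalStarSubalgebra.le_topologicalClosure _
    (NonUnitalStarAlgebra.subset_adjoin ℂ _ (Or.inl ⟨v, rfl⟩))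

theorem ambientS_mem (e : Ed) : ambientS E e ∈ subalgebra E :=
  NonUnitalStarSubalgebra.le_topologicalClosure _
    (NonUnitalStarAlgebra.subset_adjoin ℂ _ (Or.inr ⟨e, rfl⟩))

/-- The canonical homomorphism from `C*(E)` to the algebra of a representation. -/
def proj (R : CuntzKriegerRep E) : GraphCStar E →⋆ₙₐ[ℂ] R.alg where
  toFun x := x.1 R
  map_smul' _ _ := rfl
  map_zero' := rfl
  map_add' _ _ := rfl
  map_mul' _ _ := rfl
  map_star' _ := rfl

theorem ext_proj {x y : GraphCStar E} (h : ∀ R, proj R x = proj R y) : x = y :=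
  Subtype.ext (lp.ext (funext h))

theorem proj_sum {ι : Type*} (R : CuntzKriegerRep E) (t : Finset ι) (f : ι → GraphCStar E) :
    proj R (∑ i ∈ t, f i) = ∑ i ∈ t, proj R (f i) := map_sum _ _ _

variable (E) in
/-- The generators of `C*(E)`. -/
def gen : CuntzKriegerFamily E (GraphCStar E) where
  P v := ⟨ambientP E v, ambientP_mem v⟩
  S e := ⟨ambientS E e, ambientS_mem e⟩
  isProj v := ⟨ext_proj fun R => (R.fam.isProj v).isIdempotentElem,
    ext_proj fun R => (R.fam.isProj v).isSelfAdjoint⟩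
  orthogonal v w h := ext_proj fun R => R.fam.orthogonal v w h
  partialIsometry e := ext_proj fun R => R.fam.partialIsometry e
  orthogonal_ranges e f h := ext_proj fun R => R.fam.orthogonal_ranges e f h
  star_S_mul_S e := ext_proj fun R => R.fam.star_S_mul_S e
  range_le e := ext_proj fun R => R.fam.range_le e
  sum_ranges v h hne := ext_proj fun R => by
    rw [proj_sum]
    exact R.fam.sum_ranges v h hne

/-- The universal property: every family in a C*-algebra `B` is the image of the generators. -/
def lift {B : Type} [NonUnitalCStarAlgebra B] (F : CuntzKriegerFamily E B) :
    GraphCStar E →⋆ₙₐ[ℂ] B := proj ⟨B, F⟩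

theorem lift_P {B : Type} [NonUnitalCStarAlgebra B] (F : CuntzKriegerFamily E B) (v : V) :
    lift F ((gen E).P v) = F.P v := rfl

theorem lift_S {B : Type} [NonUnitalCStarAlgebra B] (F : CuntzKriegerFamily E B) (e : Ed) :
    lift F ((gen E).S e) = F.S e := rfl

/-- A closed condition stable under the `*`-algebra operations holds on all of `C*(E)` as soon as
it holds for the generators. -/
theorem mem_of_gen_mem (T : NonUnitalStarSubalgebra ℂ (GraphCStar E))
    (hT : IsClosed (T : Set (GraphCStar E))) (hP : ∀ v, (gen E).P v ∈ T)
    (hS : ∀ e, (gen E).S e ∈ T) (x : GraphCStar E) : x ∈ T := by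
  let ι := NonUnitalStarSubalgebraClass.subtype (subalgebra E)
  have hcl : IsClosed (T.map ι : Set (Ambient E)) := by
    have : IsClosed (((↑) : subalgebra E → Ambient E) '' {x | x ∈ T}) :=
      (isClosed_subalgebra E).isClosedEmbedding_subtypeVal.isClosedMap _ hT
    exact this
  have hle : subalgebra E ≤ T.map ι := by
    refine NonUnitalStarSubalgebra.topologicalClosure_minimal _ ?_ hcl
    refine NonUnitalStarAlgebra.adjoin_le ?_
    rintro _ (⟨v, rfl⟩ | ⟨e, rfl⟩)
    · exact ⟨_, hP v, rfl⟩
    · exact ⟨_, hS e, rfl⟩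
  obtain ⟨y, hy, hyx⟩ := hle x.2
  have : y = x := Subtype.ext hyx
  exact this ▸ hy

/-- Homomorphisms out of `C*(E)` are determined by the generators. -/
theorem hom_ext {B : Type*} [NonUnitalCStarAlgebra B] {φ ψ : GraphCStar E →⋆ₙₐ[ℂ] B}
    (hP : ∀ v, φ ((gen E).P v) = ψ ((gen E).P v))
    (hS : ∀ e, φ ((gen E).S e) = ψ ((gen E).S e)) : φ = ψ := by
  have hc : ∀ χ : GraphCStar E →⋆ₙₐ[ℂ] B, Continuous χ := fun χ =>
    AddMonoidHomClass.continuous_of_bound χ 1 fun x => by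
      simpa using NonUnitalStarAlgHom.norm_apply_le χ x
  refine NonUnitalStarAlgHom.ext fun x => ?_
  exact mem_of_gen_mem (NonUnitalStarAlgHom.equalizer φ ψ)
    (isClosed_eq (hc φ) (hc ψ)) hP hS x

/-! ### The unit, for finitely many vertices -/

section Unital

variable [Finite V]

variable (E) in
/-- The unit `∑ v, P v`. -/
def unit : GraphCStar E := ∑ᶠ v, (gen E).P v

theorem isSelfAdjoint_unit : star (unit E) = unit E := by
  have := Fintype.ofFinite V
  rw [unit, finsum_eq_sum_of_fintype, star_sum]
  exact Finset.sum_congr rfl fun v _ => ((gen E).isProj v).isSelfAdjoint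

theorem unit_mul_P (v : V) : unit E * (gen E).P v = (gen E).P v := by
  have := Fintype.ofFinite V
  rw [unit, finsum_eq_sum_of_fintype, Finset.sum_mul, Finset.sum_eq_single v]
  · exact ((gen E).isProj v).isIdempotentElem
  · exact fun w _ hw => (gen E).orthogonal w v hw
  · simp

theorem P_mul_unit (v : V) : (gen E).P v * unit E = (gen E).P v := by
  have h := congrArg star (unit_mul_P (E := E) v)
  rwa [star_mul, isSelfAdjoint_unit, ((gen E).isProj v).isSelfAdjoint] at h

theorem unit_mul_S (e : Ed) : unit E * (gen E).S e = (gen E).S e := by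
  rw [← (gen E).P_mul_S, ← mul_assoc, unit_mul_P]

theorem S_mul_unit (e : Ed) : (gen E).S e * unit E = (gen E).S e := by
  rw [← (gen E).S_mul_P, mul_assoc, P_mul_unit]

variable (E) in
/-- The elements on which `unit E` acts as a two-sided identity. -/
def unitSubalgebra : NonUnitalStarSubalgebra ℂ (GraphCStar E) where
  carrier := {x | unit E * x = x ∧ x * unit E = x}
  add_mem' := fun ⟨h1, h2⟩ ⟨h3, h4⟩ => ⟨by rw [mul_add, h1, h3], by rw [add_mul, h2, h4]⟩
  zero_mem' := ⟨mul_zero _, zero_mul _⟩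
  mul_mem' := fun ⟨h1, _⟩ ⟨_, h4⟩ => ⟨by rw [← mul_assoc, h1], by rw [mul_assoc, h4]⟩
  smul_mem' := fun c _ ⟨h1, h2⟩ => ⟨by rw [mul_smul_comm, h1], by rw [smul_mul_assoc, h2]⟩
  star_mem' := fun {x} ⟨h1, h2⟩ => by
    constructor
    · have := congrArg star h2
      rwa [star_mul, isSelfAdjoint_unit] at this
    · have := congrArg star h1
      rwa [star_mul, isSelfAdjoint_unit] at this

theorem mem_unitSubalgebra (x : GraphCStar E) : unit E * x = x ∧ x * unit E = x :=
  mem_of_gen_mem (unitSubalgebra E)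
    ((isClosed_eq (continuous_const.mul continuous_id) continuous_id).inter
      (isClosed_eq (continuous_id.mul continuous_const) continuous_id))
    (fun v => ⟨unit_mul_P v, P_mul_unit v⟩) (fun e => ⟨unit_mul_S e, S_mul_unit e⟩) x

instance instNormedRing : NormedRing (GraphCStar E) where
  __ := (inferInstance : NonUnitalNormedRing (GraphCStar E))
  one := unit E
  one_mul x := (mem_unitSubalgebra x).1
  mul_one x := (mem_unitSubalgebra x).2

instance instNormedAlgebra : NormedAlgebra ℂ (GraphCStar E) where
  __ := Algebra.ofModule (R := ℂ) (A := GraphCStar E) smul_mul_assoc mul_smul_comm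
  norm_smul_le := norm_smul_le

/-- If `E` has finitely many vertices, `C*(E)` is unital. -/
instance instCStarAlgebra : CStarAlgebra (GraphCStar E) where
  norm_mul_self_le := CStarRing.norm_mul_self_le (E := GraphCStar E)

theorem one_eq [Fintype V] : (1 : GraphCStar E) = ∑ v, (gen E).P v :=
  finsum_eq_sum_of_fintype _

end Unital

/-! ### The gauge action -/

/-- The endomorphism of the product of all representations that precomposes with
`F ↦ F.rotate z`. -/
def ambientGauge (z : Circle) : Ambient E →⋆ₙₐ[ℂ] Ambient E where
  toFun x := ⟨fun R => x.1 ⟨R.alg, R.fam.rotate z⟩, memℓp_infty <| by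
    obtain ⟨C, hC⟩ := memℓp_infty_iff.1 x.2
    exact ⟨C, by rintro _ ⟨R, rfl⟩; exact hC ⟨⟨R.alg, R.fam.rotate z⟩, rfl⟩⟩⟩
  map_smul' _ _ := rfl
  map_zero' := rfl
  map_add' _ _ := rfl
  map_mul' _ _ := rfl
  map_star' _ := rfl

theorem ambientGauge_mem (z : Circle) {x : Ambient E} (hx : x ∈ subalgebra E) :
    ambientGauge z x ∈ subalgebra E := by
  have hc : Continuous (ambientGauge (E := E) z) :=
    AddMonoidHomClass.continuous_of_bound _ 1 fun x => by
      simpa using NonUnitalStarAlgHom.norm_apply_le (ambientGauge (E := E) z) x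
  have hle : subalgebra E ≤ (subalgebra E).comap (ambientGauge (E := E) z) := by
    refine NonUnitalStarSubalgebra.topologicalClosure_minimal _ ?_
      ((isClosed_subalgebra E).preimage hc)
    refine NonUnitalStarAlgebra.adjoin_le ?_
    rintro _ (⟨v, rfl⟩ | ⟨e, rfl⟩)
    · exact ambientP_mem v
    · exact (subalgebra E).smul_mem (r := (z : ℂ)) (ambientS_mem e)
  exact hle hx

/-- The automorphism of `C*(E)` with `P v ↦ P v` and `S e ↦ z • S e`. -/
def gaugeAut (z : Circle) : GraphCStar E ≃⋆ₐ[ℂ] GraphCStar E where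
  toFun x := ⟨ambientGauge z x.1, ambientGauge_mem z x.2⟩
  invFun x := ⟨ambientGauge z⁻¹ x.1, ambientGauge_mem z⁻¹ x.2⟩
  left_inv x := ext_proj fun R => by
    change x.1 ⟨R.alg, (R.fam.rotate z⁻¹).rotate z⟩ = x.1 R
    rw [CuntzKriegerFamily.rotate_rotate, mul_inv_cancel, CuntzKriegerFamily.rotate_one]
  right_inv x := ext_proj fun R => by
    change x.1 ⟨R.alg, (R.fam.rotate z).rotate z⁻¹⟩ = x.1 R
    rw [CuntzKriegerFamily.rotate_rotate, inv_mul_cancel, CuntzKriegerFamily.rotate_one]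
  map_mul' _ _ := rfl
  map_add' _ _ := rfl
  map_star' _ := rfl
  map_smul' _ _ := rfl

variable (E) in
/-- The gauge action of the circle on `C*(E)`. -/
def gauge : Circle →* (GraphCStar E ≃⋆ₐ[ℂ] GraphCStar E) where
  toFun := gaugeAut
  map_one' := StarAlgEquiv.ext fun x => ext_proj fun R => by
    change x.1 ⟨R.alg, R.fam.rotate 1⟩ = x.1 R
    rw [CuntzKriegerFamily.rotate_one]
  map_mul' z w := StarAlgEquiv.ext fun x => ext_proj fun R => by
    change x.1 ⟨R.alg, R.fam.rotate (z * w)⟩ = x.1 ⟨R.alg, (R.fam.rotate z).rotate w⟩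
    rw [CuntzKriegerFamily.rotate_rotate, mul_comm]

theorem gauge_P (z : Circle) (v : V) : gauge E z ((gen E).P v) = (gen E).P v := rfl

theorem gauge_S (z : Circle) (e : Ed) : gauge E z ((gen E).S e) = (z : ℂ) • (gen E).S e := rfl

variable (E) in
/-- The gauge action restricted to the cyclic subgroup of `k`-th roots of unity: the class of `j`
in `ℤ/k` acts by `S e ↦ exp (2 π i j / k) • S e`. -/
def cyclicGauge (k : ℕ) [NeZero k] :
    Multiplicative (ZMod k) →* (GraphCStar E ≃⋆ₐ[ℂ] GraphCStar E) :=
  (gauge E).comp (ZMod.toCircle (N := k)).toMonoidHom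

/- Unfolding this instance is never needed from here on; keeping it folded lets the unital and
non-unital structures on `C*(E)` unify cheaply. -/
attribute [irreducible] instNonUnitalCStarAlgebra

end GraphCStar

/-! ## The spaces `E_n G` -/

universe u

/-- A topological space with a right action of the group `G` by continuous maps. -/
structure RightGSpace (G : Type u) [Group G] where
  /-- the underlying space -/
  carrier : Type u
  [top : TopologicalSpace carrier]
  /-- the map `x ↦ x · g` -/
  act : G → C(carrier, carrier)
  act_one : ∀ x, act 1 x = x
  act_mul : ∀ g h x, act (g * h) x = act h (act g x)

attribute [instance] RightGSpace.top

/-- The identifications defining the join of `X` and `Y`: at `t = 0` the coordinate in `Y` is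
forgotten, at `t = 1` the coordinate in `X`. -/
inductive JoinRel (X Y : Type u) : X × Y × unitInterval → X × Y × unitInterval → Prop
  | zero (x : X) (y y' : Y) : JoinRel X Y (x, y, 0) (x, y', 0)
  | one (x x' : X) (y : Y) : JoinRel X Y (x, y, 1) (x', y, 1)

/-- The topological join `X * Y`, a quotient of `X × Y × [0,1]`. -/
def TopJoin (X Y : Type u) : Type u := Quot (JoinRel X Y)

instance (X Y : Type u) [TopologicalSpace X] [TopologicalSpace Y] :
    TopologicalSpace (TopJoin X Y) :=
  inferInstanceAs (TopologicalSpace (Quot (JoinRel X Y)))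

/-- The map of joins induced by maps of the two factors. -/
def TopJoin.map {X Y : Type u} [TopologicalSpace X] [TopologicalSpace Y]
    (f : C(X, X)) (g : C(Y, Y)) : C(TopJoin X Y, TopJoin X Y) where
  toFun := Quot.map (fun p => (f p.1, g p.2.1, p.2.2)) (by
    rintro _ _ (⟨x, y, y'⟩ | ⟨x, x', y⟩)
    · exact .zero _ _ _
    · exact .one _ _ _)
  continuous_toFun := continuous_quot_lift _ (continuous_quot_mk.comp (by fun_prop))

namespace RightGSpace

variable (G : Type u) [Group G]

/-- The join of two `G`-spaces with the diagonal action. -/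
def join {G : Type u} [Group G] (X Y : RightGSpace G) : RightGSpace G where
  carrier := TopJoin X.carrier Y.carrier
  act g := TopJoin.map (X.act g) (Y.act g)
  act_one := by
    rintro ⟨x, y, t⟩
    exact congrArg (Quot.mk _) (by simp [act_one])
  act_mul := by
    rintro g h ⟨x, y, t⟩
    exact congrArg (Quot.mk _) (by simp [act_mul])

variable [TopologicalSpace G] [IsTopologicalGroup G]

/-- `G` acting on itself by right translation. -/
def self : RightGSpace G where
  carrier := G
  act g := ⟨fun h => h * g, by fun_prop⟩
  act_one := by simp
  act_mul := by simp [mul_assoc]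

/-- `E_0 G = G` and `E_{n+1} G = E_n G * G`, with the diagonal action. -/
def EG : ℕ → RightGSpace G
  | 0 => self G
  | n + 1 => (EG n).join (self G)

end RightGSpace

/-! ## Local-triviality dimensions -/

namespace LocalTriviality

section Cone

variable (G : Type*) [Group G] [TopologicalSpace G]

/-- The C*-algebra `C₀((0,1]) ⊗ C(G)`, for compact `G` identified with `C₀((0,1] × G)`. -/
abbrev ConeAlgebra : Type _ := C₀(Set.Ioc (0 : ℝ) 1 × G, ℂ)

variable {G} in
/-- Translation on the second tensor factor: `(g · f) (s, h) = f (s, h * g)`. -/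
def translate [IsTopologicalGroup G] (g : G) (f : ConeAlgebra G) : ConeAlgebra G :=
  f.comp ((Homeomorph.refl (Set.Ioc (0 : ℝ) 1)).prodCongr (Homeomorph.mulRight g)).toCocompactMap

theorem translate_apply [IsTopologicalGroup G] (g : G) (f : ConeAlgebra G)
    (s : Set.Ioc (0 : ℝ) 1) (h : G) : translate g f (s, h) = f (s, h * g) := rfl

/-- The element `t ⊗ 1`, where `t` is the identity function on `(0,1]`. -/
def tOne [CompactSpace G] : ConeAlgebra G where
  toFun p := ((p.1 : ℝ) : ℂ)
  continuous_toFun := by fun_prop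
  zero_at_infty' := by
    rw [Metric.tendsto_nhds]
    intro ε hε
    rw [Filter.eventually_iff, Filter.mem_cocompact]
    refine ⟨(Subtype.val ⁻¹' Set.Icc ε 1) ×ˢ Set.univ, ?_, ?_⟩
    · refine IsCompact.prod ?_ isCompact_univ
      rw [Subtype.isCompact_iff, Subtype.image_preimage_coe, Set.inter_eq_right.2]
      · exact isCompact_Icc
      · exact fun x hx => ⟨hε.trans_le hx.1, hx.2⟩
    · rintro ⟨s, h⟩ hs
      have h1 : ¬ ε ≤ (s : ℝ) := fun h' => hs ⟨⟨h', s.2.2⟩, trivial⟩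
      have h2 : |(s : ℝ)| < ε := by rw [abs_of_pos s.2.1]; exact not_le.1 h1
      simpa using h2

end Cone

variable {G : Type u} [Group G] [TopologicalSpace G] [IsTopologicalGroup G] [CompactSpace G]
variable {A : Type*} [CStarAlgebra A]

/-- Equivariance of a map `C₀((0,1]) ⊗ C(G) → A` for translation and the action `α`. -/
def IsEquivariant (α : G →* (A ≃⋆ₐ[ℂ] A)) (ρ : ConeAlgebra G →⋆ₙₐ[ℂ] A) : Prop :=
  ∀ g f, ρ (translate g f) = α g (ρ f)

/-- The (plain) local-triviality dimension of an action of `G` on a unital C*-algebra. -/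
def trivDim (α : G →* (A ≃⋆ₐ[ℂ] A)) : ℕ∞ :=
  ⨅ (n : ℕ) (_ : ∃ ρ : Fin (n + 1) → (ConeAlgebra G →⋆ₙₐ[ℂ] A),
    (∀ i, IsEquivariant α (ρ i)) ∧ ∑ i, ρ i (tOne G) = 1), (n : ℕ∞)

/-- The weak local-triviality dimension. -/
def weakTrivDim (α : G →* (A ≃⋆ₐ[ℂ] A)) : ℕ∞ :=
  ⨅ (n : ℕ) (_ : ∃ ρ : Fin (n + 1) → (ConeAlgebra G →⋆ₙₐ[ℂ] A),
    (∀ i, IsEquivariant α (ρ i)) ∧ IsUnit (∑ i, ρ i (tOne G))), (n : ℕ∞)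

/-- The strong local-triviality dimension: the least `n` with a `G`-equivariant unital
`*`-homomorphism `C(E_n G) → A`, where `(g · f) (x) = f (x · g)` for `f ∈ C(E_n G)`. -/
def strongTrivDim (α : G →* (A ≃⋆ₐ[ℂ] A)) : ℕ∞ :=
  ⨅ (n : ℕ) (_ : ∃ φ : C((RightGSpace.EG G n).carrier, ℂ) →⋆ₐ[ℂ] A,
    ∀ g f, φ (f.comp ((RightGSpace.EG G n).act g)) = α g (φ f)), (n : ℕ∞)

end LocalTriviality

end

/-! Lower bound. If one equivariant `ρ` has `ρ (t ⊗ 1)` invertible, then dividing `ρ (t ⊗ δ₁)` by it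
gives an idempotent `p` whose translates under the `k`-th roots of unity add up to `1`
(`exists_isIdempotentElem_sum_eq_one`). Represent `C*(C_n)` on `n × n` matrices by matrix units and
take the trace. This functional is not gauge invariant, but on the gauge orbit of an idempotent it
is a continuous function on the circle with values in the natural numbers, hence constant
(`cycleTrace_gauge`). So `n`, the trace of `1`, is `k` times the trace of `p`, and `k ∣ n`.

Upper bounds. An equivariant map from a set containing the spectrum of a normal `u`, where `u` is
scaled by the action, into `E_m G` gives an equivariant homomorphism on `C(E_m G)` by functional
calculus (`exists_equivariant_starAlgHom`). The sum of all edges is a unitary scaled by the gauge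
action, with spectrum in the circle; the circle maps equivariantly to `ℤ/k * ℤ/k`, seen as a graph,
by a closed zigzag path (`circleToJoin`). This gives `m = 1` always.

If `k ∣ n`, the vertices split into classes modulo `k`, permuted cyclically by the edge unitary.
Altering that unitary on a single class gives one with `k`-th power `1` that is still scaled by the
roots of unity (`exists_unitary_pow_eq_one`). Its spectrum lies in the group of `k`-th roots of
unity, a copy of `ℤ/k = E_0 G`, so `m = 0`.

Only the strong dimension needs explicit constructions. A homomorphism on `C(E_m G)` with `m ≤ 1`
bounds the plain dimension by `m`, and the weak dimension never exceeds the plain one. -/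

noncomputable section

/-! ## The trace obstruction -/

/-- The trace of an idempotent matrix is a natural number. -/
theorem Matrix.exists_trace_eq_natCast_of_isIdempotentElem {ι : Type*} [Fintype ι] [DecidableEq ι]
    {p : Matrix ι ι ℂ} (hp : IsIdempotentElem p) : ∃ m : ℕ, p.trace = m := by
  have h : IsIdempotentElem (Matrix.toLin' p) := by
    rw [IsIdempotentElem, Module.End.mul_eq_comp, ← Matrix.toLin'_mul, hp.eq]
  refine ⟨Module.finrank ℂ (LinearMap.range (Matrix.toLin' p)), ?_⟩
  rw [← Matrix.trace_toLin'_eq]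
  exact (LinearMap.IsIdempotentElem.isProj_range _ h).trace

/-- A continuous complex function on a connected space with natural number values is constant. -/
theorem eq_of_continuous_of_forall_exists_natCast {X : Type*} [TopologicalSpace X]
    [PreconnectedSpace X] {f : X → ℂ} (hf : Continuous f) (h : ∀ x, ∃ m : ℕ, f x = m) (x y : X) :
    f x = f y := by
  have hd : DiscreteTopology (Set.range ((↑) : ℕ → ℂ)) :=
    (Complex.isometry_ofReal.isEmbedding.comp
      Nat.isClosedEmbedding_coe_real.isEmbedding).toHomeomorph.symm.isEmbedding.discreteTopology
  exact isPreconnected_univ.constant_of_mapsTo (T := Set.range ((↑) : ℕ → ℂ))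
    (isDiscrete_iff_discreteTopology.2 hd) hf.continuousOn
    (fun x _ => (h x).imp fun _ h => h.symm) trivial trivial

namespace GraphCStar

/-- The elements with continuous orbit map form a `*`-subalgebra containing the generators. It is
closed because the gauge automorphisms are contractive, so an approximation of the element
approximates its orbit map uniformly. -/
theorem continuous_gauge {V Ed : Type} {E : DirectedGraph V Ed} (x : GraphCStar E)
    [Finite V] : Continuous fun z : Circle => gauge E z x := by
  let T : NonUnitalStarSubalgebra ℂ (GraphCStar E) :=
    { carrier := {x | Continuous fun z : Circle => gauge E z x}
      add_mem' := fun {a b} ha hb => by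
        simp only [Set.mem_ofPred_eq, map_add]
        exact ha.add hb
      zero_mem' := by simpa using continuous_const
      mul_mem' := fun {a b} ha hb => by
        simp only [Set.mem_ofPred_eq, map_mul]
        exact ha.mul hb
      smul_mem' := fun c a ha => by
        simp only [Set.mem_ofPred_eq, map_smul]
        exact ha.const_smul c
      star_mem' := fun {a} ha => by
        simp only [Set.mem_ofPred_eq, map_star]
        exact ha.star }
  have hT : IsClosed (T : Set (GraphCStar E)) := by
    rw [← closure_subset_iff_isClosed]
    intro a ha
    refine continuous_of_uniform_approx_of_continuous fun u hu => ?_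
    obtain ⟨ε, hε, h⟩ := Metric.mem_uniformity_dist.1 hu
    obtain ⟨b, hb, hab⟩ := Metric.mem_closure_iff.1 ha ε hε
    refine ⟨_, hb, fun z => h ?_⟩
    refine lt_of_le_of_lt ?_ hab
    rw [dist_eq_norm, dist_eq_norm, ← map_sub]
    exact NonUnitalStarAlgHom.norm_apply_le (gauge E z) (a - b)
  refine mem_of_gen_mem T hT (fun v => ?_) (fun e => ?_) x
  · change Continuous fun z : Circle => gauge E z ((gen E).P v)
    simpa only [gauge_P] using continuous_const
  · change Continuous fun z : Circle => gauge E z ((gen E).S e)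
    simp only [gauge_S]
    exact Continuous.smul (by fun_prop) continuous_const

/-! ### The trace on idempotents in the algebra of a cycle -/

section cycleTrace

open scoped ComplexOrder

/-- The representation of the relations of a cycle by matrix units. -/
def cycleMatrixFamily (n : ℕ) [NeZero n] :
    CuntzKriegerFamily (cycleGraph n) (CStarMatrix (Fin n) (Fin n) ℂ) where
  P i := CStarMatrix.ofMatrix (Matrix.single i i 1)
  S i := CStarMatrix.ofMatrix (Matrix.single i (i + 1) 1)
  isProj i := by
    constructor
    · have : Matrix.single i i (1 : ℂ) * Matrix.single i i 1 = Matrix.single i i 1 := by simp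
      exact this
    · change (Matrix.single i i (1 : ℂ)).conjTranspose = Matrix.single i i 1
      simp
  orthogonal i j h := by
    have : Matrix.single i i (1 : ℂ) * Matrix.single j j 1 = 0 := by simp [h]
    exact this
  partialIsometry i := by
    change Matrix.single i (i + 1) (1 : ℂ) * (Matrix.single i (i + 1) (1 : ℂ)).conjTranspose
      * Matrix.single i (i + 1) (1 : ℂ) = Matrix.single i (i + 1) (1 : ℂ)
    simp
  orthogonal_ranges i j h := by
    change (Matrix.single i (i + 1) (1 : ℂ) * (Matrix.single i (i + 1) (1 : ℂ)).conjTranspose)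
      * (Matrix.single j (j + 1) (1 : ℂ) * (Matrix.single j (j + 1) (1 : ℂ)).conjTranspose) = 0
    simp [h]
  star_S_mul_S i := by
    change (Matrix.single i (i + 1) (1 : ℂ)).conjTranspose * Matrix.single i (i + 1) (1 : ℂ)
      = Matrix.single (i + 1) (i + 1) 1
    simp
  range_le i := by
    change Matrix.single i i (1 : ℂ) * (Matrix.single i (i + 1) (1 : ℂ) *
      (Matrix.single i (i + 1) (1 : ℂ)).conjTranspose) =
      Matrix.single i (i + 1) (1 : ℂ) * (Matrix.single i (i + 1) (1 : ℂ)).conjTranspose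
    simp
  sum_ranges i h _ := by
    have : h.toFinset = {i} := by ext; simp [cycleGraph]
    rw [this, Finset.sum_singleton]
    change Matrix.single i i (1 : ℂ) = Matrix.single i (i + 1) (1 : ℂ) *
      (Matrix.single i (i + 1) (1 : ℂ)).conjTranspose
    simp

/-- The trace of an element of the C*-algebra of a cycle in the representation by matrix units. -/
def cycleTrace (n : ℕ) [NeZero n] (x : GraphCStar (cycleGraph n)) : ℂ :=
  Matrix.trace (CStarMatrix.ofMatrix.symm (lift (cycleMatrixFamily n) x))

variable (n : ℕ) [NeZero n]

theorem cycleTrace_sum {ι : Type*} (s : Finset ι) (f : ι → GraphCStar (cycleGraph n)) :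
    cycleTrace n (∑ i ∈ s, f i) = ∑ i ∈ s, cycleTrace n (f i) := by
  rw [cycleTrace, map_sum]
  exact Matrix.trace_sum s fun i => CStarMatrix.ofMatrix.symm (lift (cycleMatrixFamily n) (f i))

theorem cycleTrace_one : cycleTrace n 1 = n := by
  rw [one_eq, cycleTrace_sum]
  have : ∀ v, cycleTrace n ((gen (cycleGraph n)).P v) = 1 := fun v =>
    Matrix.trace_single_eq_same v 1
  simp [this]

theorem continuous_cycleTrace : Continuous (cycleTrace n) := by
  have hc : Continuous (lift (cycleMatrixFamily n)) :=
    AddMonoidHomClass.continuous_of_bound _ 1 fun x => by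
      simpa using NonUnitalStarAlgHom.norm_apply_le (lift (cycleMatrixFamily n)) x
  exact Continuous.matrix_trace (A := fun x => CStarMatrix.ofMatrix.symm (lift _ x)) hc

theorem exists_cycleTrace_eq_natCast {p : GraphCStar (cycleGraph n)} (hp : IsIdempotentElem p) :
    ∃ m : ℕ, cycleTrace n p = m := by
  apply Matrix.exists_trace_eq_natCast_of_isIdempotentElem
  have := hp.map (lift (cycleMatrixFamily n))
  exact this

/-- The trace of an idempotent is invariant under the gauge action, as the circle is connected. -/
theorem cycleTrace_gauge {p : GraphCStar (cycleGraph n)} (hp : IsIdempotentElem p) (z : Circle) :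
    cycleTrace n (gauge _ z p) = cycleTrace n p := by
  have h := eq_of_continuous_of_forall_exists_natCast
    ((continuous_cycleTrace n).comp (continuous_gauge p))
    (fun z => exists_cycleTrace_eq_natCast n (hp.map (gauge _ z))) z 1
  simpa using h

/-- If the translates of an idempotent under the `k`-th roots of unity add up to one, then
`k` divides `n`. -/
theorem dvd_of_sum_cyclicGauge_eq_one (k : ℕ) [NeZero k] {p : GraphCStar (cycleGraph n)}
    (hp : IsIdempotentElem p) (h : ∑ g, cyclicGauge (cycleGraph n) k g p = 1) : k ∣ n := by
  obtain ⟨m, hm⟩ := exists_cycleTrace_eq_natCast n hp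
  have h1 := congrArg (cycleTrace n) h
  -- All `k` translates of `p` have trace `m`, so taking traces of the sum gives `n = k * m`.
  have h2 : ∀ g, cycleTrace n (cyclicGauge (cycleGraph n) k g p) = m := fun g =>
    (cycleTrace_gauge n hp _).trans hm
  rw [cycleTrace_sum, cycleTrace_one, Finset.sum_congr rfl fun g _ => h2 g, Finset.sum_const,
    Finset.card_univ, Fintype.card_multiplicative, ZMod.card, nsmul_eq_mul] at h1
  exact ⟨m, by exact_mod_cast h1.symm⟩

end cycleTrace

end GraphCStar

/-! ### An idempotent from weak dimension zero -/

namespace LocalTriviality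

theorem translate_tOne {G : Type*} [Group G] [TopologicalSpace G] [IsTopologicalGroup G]
    [CompactSpace G] (g : G) : translate g (tOne G) = tOne G := by
  ext ⟨s, x⟩; rfl

section

variable {G : Type*} [TopologicalSpace G] [DiscreteTopology G] [Finite G] [DecidableEq G]

/-- The element `t ⊗ δ` where `δ` is the indicator function of a point. -/
def tSingle (g : G) : ConeAlgebra G where
  toFun p := if p.2 = g then (tOne G) p else 0
  continuous_toFun := by
    have : Continuous fun h : G => if h = g then (1 : ℂ) else 0 := continuous_of_discreteTopology
    convert (this.comp continuous_snd).mul (tOne G).continuous using 2 with p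
    by_cases h : p.2 = g <;> simp [h]
  zero_at_infty' := by
    refine squeeze_zero_norm (fun p => ?_) (tendsto_zero_iff_norm_tendsto_zero.1
      (tOne G).zero_at_infty')
    by_cases h : p.2 = g
    · rw [if_pos h]; rfl
    · rw [if_neg h, norm_zero]; exact norm_nonneg _

theorem sum_tSingle [Fintype G] : ∑ g : G, tSingle g = tOne G := by
  ext ⟨s, x⟩
  have : (∑ g : G, tSingle g) (s, x) = ∑ g : G, tSingle g (s, x) :=
    map_sum (AddMonoidHom.mk' (fun f : ConeAlgebra G => f (s, x)) fun _ _ => rfl) _ _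
  rw [this]
  change ∑ g : G, (if x = g then ((s : ℝ) : ℂ) else 0) = ((s : ℝ) : ℂ)
  simp

/-- This identity makes the quotient of `t ⊗ δ` by `t ⊗ 1` idempotent once `t ⊗ 1` has become
invertible. -/
theorem tSingle_mul_self (g : G) : tSingle g * tSingle g = tSingle g * tOne G := by
  ext ⟨s, x⟩
  change (if x = g then ((s : ℝ) : ℂ) else 0) * (if x = g then ((s : ℝ) : ℂ) else 0) =
    (if x = g then ((s : ℝ) : ℂ) else 0) * ((s : ℝ) : ℂ)
  split_ifs <;> simp

end

variable {G : Type*} [Group G] [TopologicalSpace G] [DiscreteTopology G] [IsTopologicalGroup G]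
  [DecidableEq G] {A : Type*} [CStarAlgebra A]

theorem translate_tSingle [Finite G] (g h : G) : translate g (tSingle h) = tSingle (h * g⁻¹) := by
  ext ⟨s, x⟩
  rw [translate_apply]
  change (if x * g = h then ((s : ℝ) : ℂ) else 0) = if x = h * g⁻¹ then ((s : ℝ) : ℂ) else 0
  simp only [eq_mul_inv_iff_mul_eq]

/-- If an action of a finite group has weak local-triviality dimension zero, then the translates
of some idempotent add up to one. -/
theorem exists_isIdempotentElem_sum_eq_one [Fintype G] (α : G →* (A ≃⋆ₐ[ℂ] A))
    (ρ : ConeAlgebra G →⋆ₙₐ[ℂ] A) (hρ : IsEquivariant α ρ) (hu : IsUnit (ρ (tOne G))) :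
    ∃ p : A, IsIdempotentElem p ∧ ∑ g, α g p = 1 := by
  obtain ⟨a, ha⟩ := hu
  have hcomm : Commute (ρ (tSingle (1 : G))) (a : A) := by
    rw [ha, Commute, SemiconjBy, ← map_mul, ← map_mul, mul_comm]
  -- The element `t ⊗ 1` is fixed by translation, so `a` is fixed by the action, and so is its
  -- inverse by uniqueness.
  have hα : ∀ g, α g (↑a⁻¹ : A) = ↑a⁻¹ := fun g => by
    have h1 : α g (a : A) = a := by rw [ha, ← hρ, translate_tOne]
    have h2 : α g (↑a⁻¹ : A) * a = 1 := by
      have h := map_mul (α g) (↑a⁻¹ : A) (a : A)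
      rwa [Units.inv_mul, map_one, h1, eq_comm] at h
    exact (Units.inv_eq_of_mul_eq_one_left (u := a) h2).symm
  refine ⟨ρ (tSingle 1) * ↑a⁻¹, ?_, ?_⟩
  · have h2 : ρ (tSingle (1 : G)) * ρ (tSingle 1) = ρ (tSingle 1) * a := by
      rw [ha, ← map_mul, tSingle_mul_self, map_mul]
    rw [IsIdempotentElem, (hcomm.units_inv_right).symm.mul_mul_mul_comm, h2, mul_assoc,
      ← mul_assoc (a : A), Units.mul_inv, one_mul]
  · have h3 : ∀ g, α g (ρ (tSingle 1) * ↑a⁻¹) = ρ (tSingle g⁻¹) * ↑a⁻¹ := fun g => by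
      rw [map_mul, hα, ← hρ, translate_tSingle, one_mul]
    rw [Finset.sum_congr rfl fun g _ => h3 g, ← Finset.sum_mul,
      show ∑ g : G, ρ (tSingle g⁻¹) = ∑ g, ρ (tSingle g) from
        Fintype.sum_equiv (Equiv.inv G) _ _ fun _ => rfl, ← map_sum, sum_tSingle, ← ha, Units.mul_inv]

end LocalTriviality

/-! ## Comparison of the dimensions -/

namespace ZeroAtInftyContinuousMap

variable {X Y : Type*} [TopologicalSpace X] [TopologicalSpace Y] [T2Space Y]

theorem continuous_extend_zero {e : X → Y} (he : IsOpenEmbedding e) (f : C₀(X, ℂ)) :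
    Continuous (Function.extend e f 0) := by
  refine continuous_iff_continuousAt.2 fun y => ?_
  by_cases hy : y ∈ Set.range e
  · obtain ⟨x, rfl⟩ := hy
    rw [← he.continuousAt_iff, Function.extend_comp he.injective]
    exact f.continuous.continuousAt
  · have h0 : Function.extend e f 0 y = 0 := Function.extend_apply' _ _ _ hy
    rw [ContinuousAt, h0, Metric.tendsto_nhds]
    intro ε hε
    obtain ⟨K, hK, hKf⟩ := Filter.mem_cocompact.1
      ((Metric.tendsto_nhds.1 f.zero_at_infty') ε hε)
    -- Outside the compact set `K` the function is smaller than `ε`. Its image is compact in a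
    -- Hausdorff space, hence closed, and misses `y`.
    have hopen : IsOpen (e '' K)ᶜ := (hK.image he.continuous).isClosed.isOpen_compl
    filter_upwards [hopen.mem_nhds fun ⟨x, _, hx⟩ => hy ⟨x, hx⟩] with z hz
    by_cases hz' : z ∈ Set.range e
    · obtain ⟨x, rfl⟩ := hz'
      rw [he.injective.extend_apply]
      exact hKf fun hx => hz ⟨x, hx, rfl⟩
    · rw [Function.extend_apply' _ _ _ hz']
      simpa using hε

/-- Extension by zero along an open embedding. -/
def extendZero {e : X → Y} (he : IsOpenEmbedding e) : C₀(X, ℂ) →⋆ₙₐ[ℂ] C(Y, ℂ) where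
  toFun f := ⟨Function.extend e f 0, continuous_extend_zero he f⟩
  map_smul' c f := by
    ext y
    by_cases hy : y ∈ Set.range e
    · obtain ⟨x, rfl⟩ := hy; simp [he.injective.extend_apply]
    · simp [Function.extend_apply' _ _ _ hy]
  map_zero' := by
    ext y
    by_cases hy : y ∈ Set.range e
    · obtain ⟨x, rfl⟩ := hy; simp [he.injective.extend_apply]
    · simp [Function.extend_apply' _ _ _ hy]
  map_add' f g := by
    ext y
    by_cases hy : y ∈ Set.range e
    · obtain ⟨x, rfl⟩ := hy; simp [he.injective.extend_apply]
    · simp [Function.extend_apply' _ _ _ hy]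
  map_mul' f g := by
    ext y
    by_cases hy : y ∈ Set.range e
    · obtain ⟨x, rfl⟩ := hy; simp [he.injective.extend_apply]
    · simp [Function.extend_apply' _ _ _ hy]
  map_star' f := by
    ext y
    by_cases hy : y ∈ Set.range e
    · obtain ⟨x, rfl⟩ := hy; simp [he.injective.extend_apply]
    · simp [Function.extend_apply' _ _ _ hy]

theorem extendZero_apply {e : X → Y} (he : IsOpenEmbedding e) (f : C₀(X, ℂ)) (x : X) :
    extendZero he f (e x) = f x :=
  he.injective.extend_apply _ _ _

theorem extendZero_apply_of_notMem {e : X → Y} (he : IsOpenEmbedding e) (f : C₀(X, ℂ)) {y : Y}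
    (hy : y ∉ Set.range e) : extendZero he f y = 0 :=
  Function.extend_apply' _ _ _ hy

end ZeroAtInftyContinuousMap

namespace LocalTriviality

open ZeroAtInftyContinuousMap

/-! ### From cones to joins -/

section Cone

variable (G : Type*)

/-- The inclusion of `(0,1] × G` into `[0,1] × G`. -/
def coneIncl (p : Set.Ioc (0 : ℝ) 1 × G) : unitInterval × G := (⟨p.1, p.1.2.1.le, p.1.2.2⟩, p.2)

theorem mem_range_coneIncl (p : unitInterval × G) : p ∈ Set.range (coneIncl G) ↔ 0 < (p.1 : ℝ) := by
  constructor
  · rintro ⟨q, rfl⟩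
    exact q.1.2.1
  · intro h
    exact ⟨(⟨p.1, h, p.1.2.2⟩, p.2), rfl⟩

variable [TopologicalSpace G]

theorem isOpenEmbedding_coneIncl : IsOpenEmbedding (coneIncl G) := by
  have h1 : IsEmbedding fun s : Set.Ioc (0 : ℝ) 1 => (⟨s, s.2.1.le, s.2.2⟩ : unitInterval) :=
    IsEmbedding.of_comp (by fun_prop) continuous_subtype_val IsEmbedding.subtypeVal
  refine ⟨h1.prodMap IsEmbedding.id, ?_⟩
  have : Set.range (coneIncl G) = {p : unitInterval × G | 0 < (p.1 : ℝ)} :=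
    Set.ext fun p => mem_range_coneIncl G p
  rw [this]
  exact isOpen_lt continuous_const (by fun_prop)

variable [T2Space G]

/-- Extension by zero from `(0,1] × G` to `[0,1] × G`. -/
def coneExtend : ConeAlgebra G →⋆ₙₐ[ℂ] C(unitInterval × G, ℂ) :=
  extendZero (isOpenEmbedding_coneIncl G)

theorem coneExtend_zero (f : ConeAlgebra G) (g : G) : coneExtend G f (0, g) = 0 :=
  extendZero_apply_of_notMem _ _ (by rw [mem_range_coneIncl]; exact lt_irrefl _)

theorem coneExtend_tOne [CompactSpace G] (p : unitInterval × G) :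
    coneExtend G (tOne G) p = ((p.1 : ℝ) : ℂ) := by
  by_cases hp : p ∈ Set.range (coneIncl G)
  · obtain ⟨q, rfl⟩ := hp
    exact extendZero_apply _ _ q
  · refine (extendZero_apply_of_notMem _ _ hp).trans ?_
    rw [mem_range_coneIncl, not_lt] at hp
    simp [le_antisymm hp p.1.2.1]

theorem coneExtend_translate [Group G] [IsTopologicalGroup G] (g : G) (f : ConeAlgebra G)
    (s : unitInterval) (h : G) : coneExtend G (translate g f) (s, h) = coneExtend G f (s, h * g) := by
  by_cases hp : 0 < (s : ℝ)
  · have h1 : ∀ f : ConeAlgebra G, ∀ x, coneExtend G f (s, x) = f (⟨s, hp, s.2.2⟩, x) := fun f x =>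
      extendZero_apply (isOpenEmbedding_coneIncl G) f (⟨s, hp, s.2.2⟩, x)
    rw [h1, h1, translate_apply]
  · have h1 : s = 0 := Subtype.ext (le_antisymm (not_lt.1 hp) s.2.1)
    rw [h1, coneExtend_zero, coneExtend_zero]

end Cone

section Join

variable (X Y : Type u) [TopologicalSpace X] [TopologicalSpace Y] [T2Space X] [T2Space Y]

/-- The homomorphism `C₀((0,1]) ⊗ C(X) → C(X * Y)` dual to the partially defined projection from
the join to the first factor. -/
def joinLeft : ConeAlgebra X →⋆ₙₐ[ℂ] C(TopJoin X Y, ℂ) where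
  -- The cone coordinate for `X` is `1 - t`: it vanishes at `t = 1`, exactly where the point of `X`
  -- is forgotten.
  toFun f := ⟨Quot.lift (fun p => coneExtend X f (unitInterval.symm p.2.2, p.1)) (by
      rintro _ _ (⟨x, y, y'⟩ | ⟨x, x', y⟩)
      · rfl
      · simp [coneExtend_zero]), continuous_quot_lift _ (by fun_prop)⟩
  map_smul' c f := by ext ⟨p⟩; exact DFunLike.congr_fun (map_smul (coneExtend X) c f) _
  map_zero' := by ext ⟨p⟩; exact DFunLike.congr_fun (map_zero (coneExtend X)) _
  map_add' f g := by ext ⟨p⟩; exact DFunLike.congr_fun (map_add (coneExtend X) f g) _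
  map_mul' f g := by ext ⟨p⟩; exact DFunLike.congr_fun (map_mul (coneExtend X) f g) _
  map_star' f := by ext ⟨p⟩; exact DFunLike.congr_fun (map_star (coneExtend X) f) _

/-- The homomorphism `C₀((0,1]) ⊗ C(Y) → C(X * Y)` dual to the partially defined projection from
the join to the second factor. -/
def joinRight : ConeAlgebra Y →⋆ₙₐ[ℂ] C(TopJoin X Y, ℂ) where
  toFun f := ⟨Quot.lift (fun p => coneExtend Y f (p.2.2, p.2.1)) (by
      rintro _ _ (⟨x, y, y'⟩ | ⟨x, x', y⟩)
      · simp [coneExtend_zero]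
      · rfl), continuous_quot_lift _ (by fun_prop)⟩
  map_smul' c f := by ext ⟨p⟩; exact DFunLike.congr_fun (map_smul (coneExtend Y) c f) _
  map_zero' := by ext ⟨p⟩; exact DFunLike.congr_fun (map_zero (coneExtend Y)) _
  map_add' f g := by ext ⟨p⟩; exact DFunLike.congr_fun (map_add (coneExtend Y) f g) _
  map_mul' f g := by ext ⟨p⟩; exact DFunLike.congr_fun (map_mul (coneExtend Y) f g) _
  map_star' f := by ext ⟨p⟩; exact DFunLike.congr_fun (map_star (coneExtend Y) f) _

theorem joinLeft_tOne_add_joinRight_tOne [CompactSpace X] [CompactSpace Y] :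
    joinLeft X Y (tOne X) + joinRight X Y (tOne Y) = 1 := by
  ext ⟨x, y, s⟩
  change coneExtend X (tOne X) (unitInterval.symm s, x) + coneExtend Y (tOne Y) (s, y) = 1
  rw [coneExtend_tOne, coneExtend_tOne]
  simp

end Join

/-! ### Inequalities between the three dimensions -/

section Bounds

variable {G : Type u} [Group G] [TopologicalSpace G] [IsTopologicalGroup G] [CompactSpace G]
variable {A : Type*} [CStarAlgebra A] (α : G →* (A ≃⋆ₐ[ℂ] A))

theorem weakTrivDim_le_trivDim : weakTrivDim α ≤ trivDim α :=
  iInf_mono fun _ => iInf_mono' fun ⟨ρ, h, h1⟩ => ⟨⟨ρ, h, h1 ▸ isUnit_one⟩, le_rfl⟩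

/-- Evaluation at `1` in the first variable. -/
def coneEvalOne : ConeAlgebra G →⋆ₙₐ[ℂ] C(G, ℂ) where
  toFun f := ⟨fun g => f (⟨1, by simp⟩, g), by fun_prop⟩
  map_smul' _ _ := rfl
  map_zero' := rfl
  map_add' _ _ := rfl
  map_mul' _ _ := rfl
  map_star' _ := rfl

theorem trivDim_eq_zero (φ : C((RightGSpace.EG G 0).carrier, ℂ) →⋆ₐ[ℂ] A)
    (hφ : ∀ g f, φ (f.comp ((RightGSpace.EG G 0).act g)) = α g (φ f)) : trivDim α = 0 := by
  refine le_antisymm (iInf₂_le_of_le 0 ?_ le_rfl) bot_le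
  refine ⟨fun _ => (φ : C((RightGSpace.EG G 0).carrier, ℂ) →⋆ₙₐ[ℂ] A).comp coneEvalOne,
    fun _ g f => hφ g (coneEvalOne f), ?_⟩
  rw [Fin.sum_univ_one]
  have : coneEvalOne (tOne G) = 1 := by
    ext g
    exact Complex.ofReal_one
  exact (congrArg φ this).trans (map_one φ)

/-- The cones over the two factors of `G * G` give two equivariant homomorphisms into `C(G * G)`;
their values at `t ⊗ 1` are the join coordinates `1 - t` and `t`, a partition of unity. -/
theorem trivDim_le_one [T2Space G] (φ : C((RightGSpace.EG G 1).carrier, ℂ) →⋆ₐ[ℂ] A)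
    (hφ : ∀ g f, φ (f.comp ((RightGSpace.EG G 1).act g)) = α g (φ f)) : trivDim α ≤ 1 := by
  refine iInf₂_le_of_le 1 ?_ le_rfl
  let φ' : C((RightGSpace.EG G 1).carrier, ℂ) →⋆ₙₐ[ℂ] A := φ
  refine ⟨![φ'.comp (joinLeft G G), φ'.comp (joinRight G G)], ?_, ?_⟩
  · rw [Fin.forall_fin_two]
    constructor
    · intro g f
      refine Eq.trans (congrArg φ ?_) (hφ g (joinLeft G G f))
      ext ⟨x, y, s⟩
      exact coneExtend_translate G g f _ _
    · intro g f
      refine Eq.trans (congrArg φ ?_) (hφ g (joinRight G G f))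
      ext ⟨x, y, s⟩
      exact coneExtend_translate G g f _ _
  · rw [Fin.sum_univ_two]
    refine (map_add φ (joinLeft G G (tOne G)) (joinRight G G (tOne G))).symm.trans ?_
    rw [joinLeft_tOne_add_joinRight_tOne]
    exact map_one φ

theorem all_trivDim_eq_zero (h : ∃ φ : C((RightGSpace.EG G 0).carrier, ℂ) →⋆ₐ[ℂ] A,
    ∀ g f, φ (f.comp ((RightGSpace.EG G 0).act g)) = α g (φ f)) :
    weakTrivDim α = 0 ∧ trivDim α = 0 ∧ strongTrivDim α = 0 := by
  obtain ⟨φ, hφ⟩ := h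
  have h1 := trivDim_eq_zero α φ hφ
  exact ⟨le_antisymm (h1 ▸ weakTrivDim_le_trivDim α) bot_le, h1,
    le_antisymm (iInf₂_le_of_le 0 ⟨φ, hφ⟩ le_rfl) bot_le⟩

theorem one_le_weakTrivDim
    (h : ∀ ρ : ConeAlgebra G →⋆ₙₐ[ℂ] A, IsEquivariant α ρ → ¬ IsUnit (ρ (tOne G))) :
    1 ≤ weakTrivDim α := by
  refine le_iInf₂ fun n hn => ?_
  rcases n with _ | n
  · obtain ⟨ρ, h1, h2⟩ := hn
    rw [Fin.sum_univ_one] at h2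
    exact absurd h2 (h _ (h1 0))
  · exact_mod_cast Nat.succ_pos n

theorem one_le_strongTrivDim (h : 1 ≤ trivDim α) : 1 ≤ strongTrivDim α := by
  refine le_iInf₂ fun n hn => ?_
  rcases n with _ | n
  · obtain ⟨φ, hφ⟩ := hn
    rw [trivDim_eq_zero α φ hφ] at h
    simp at h
  · exact_mod_cast Nat.succ_pos n

theorem all_trivDim_eq_one [T2Space G]
    (h : ∀ ρ : ConeAlgebra G →⋆ₙₐ[ℂ] A, IsEquivariant α ρ → ¬ IsUnit (ρ (tOne G)))
    (h' : ∃ φ : C((RightGSpace.EG G 1).carrier, ℂ) →⋆ₐ[ℂ] A,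
      ∀ g f, φ (f.comp ((RightGSpace.EG G 1).act g)) = α g (φ f)) :
    weakTrivDim α = 1 ∧ trivDim α = 1 ∧ strongTrivDim α = 1 := by
  obtain ⟨φ, hφ⟩ := h'
  have h1 := one_le_weakTrivDim α h
  have h2 := weakTrivDim_le_trivDim α
  have h3 := trivDim_le_one α φ hφ
  exact ⟨le_antisymm (h2.trans h3) h1, le_antisymm h3 (h1.trans h2),
    le_antisymm (iInf₂_le_of_le 1 ⟨φ, hφ⟩ le_rfl) (one_le_strongTrivDim α (h1.trans h2))⟩

end Bounds

/-! ### Equivariant functional calculus -/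

/-- Let `u` be a normal element on which the action is by the scalars `χ`. An equivariant map from
a compact set of complex numbers containing the spectrum of `u` to a `G`-space `Y` induces an
equivariant homomorphism on `C(Y)`. -/
theorem exists_equivariant_starAlgHom {G : Type*} {A : Type*} [CStarAlgebra A] (α : G → A ≃⋆ₐ[ℂ] A)
    {Y : Type*} [TopologicalSpace Y] (act : G → C(Y, Y)) (χ : G → ℂ) (u : A) [IsStarNormal u]
    (hu : ∀ g, α g u = χ g • u) (X : Set ℂ) [CompactSpace X] (hX : spectrum ℂ u ⊆ X)
    (q : C(X, Y)) (r : G → C(X, X)) (hr : ∀ g x, (r g x : ℂ) = χ g * x)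
    (hq : ∀ g x, q (r g x) = act g (q x)) :
    ∃ φ : C(Y, ℂ) →⋆ₐ[ℂ] A, ∀ g f, φ (f.comp (act g)) = α g (φ f) := by
  let ψ : C(X, ℂ) →⋆ₐ[ℂ] A := (cfcHom (R := ℂ) (a := u) ‹_›).comp
    (ContinuousMap.compStarAlgHom' ℂ ℂ ⟨Set.inclusion hX, continuous_inclusion hX⟩)
  have hψX : ψ (Polynomial.toContinuousMapOnAlgHom X Polynomial.X) = u := by
    refine Eq.trans (congrArg (cfcHom (R := ℂ) (a := u) ‹_›) ?_) (cfcHom_id _)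
    ext x
    simp
  have hcont : ∀ ψ : C(X, ℂ) →⋆ₐ[ℂ] A, Continuous ψ := fun ψ =>
    AddMonoidHomClass.continuous_of_bound ψ 1 fun x => by
      simpa using NonUnitalStarAlgHom.norm_apply_le ψ x
  -- Both sides are continuous `*`-homomorphisms on `C(X)`, so by Stone–Weierstrass they need only
  -- agree at the coordinate function, which both send to `χ g • u`.
  have hψ : ∀ g, ψ.comp (ContinuousMap.compStarAlgHom' ℂ ℂ (r g)) =
      ((α g : A ≃⋆ₐ[ℂ] A) : A →⋆ₐ[ℂ] A).comp ψ := fun g => by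
    refine ContinuousMap.starAlgHom_ext_map_X (hcont _) (hcont _) ?_
    change ψ _ = α g (ψ _)
    rw [hψX, hu, ← hψX, ← map_smul]
    congr 1
    ext x
    simp [hr]
  refine ⟨ψ.comp (ContinuousMap.compStarAlgHom' ℂ ℂ q), fun g f => ?_⟩
  refine Eq.trans (congrArg ψ ?_) (DFunLike.congr_fun (hψ g) (f.comp q))
  ext x
  exact congrArg f (hq g x).symm

end LocalTriviality

/-! ## Unitaries in the C*-algebra of a cycle -/

section MatrixUnits

variable {k : ℕ} [NeZero k] {A : Type*} [Ring A] [StarRing A] {v : ZMod k → A} {q : A}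

/-- Powers of the cyclic permutation built from a system of matrix units `star (v i) * v j`. -/
theorem sum_star_mul_succ_pow (hv : ∀ j l, v j * star (v l) = if j = l then q else 0)
    (hq : ∀ j, q * v j = v j) (h1 : ∑ j, star (v j) * v j = 1) (m : ℕ) :
    (∑ j, star (v j) * v (j + 1)) ^ m = ∑ j, star (v j) * v (j + m) := by
  induction m with
  | zero => simp [h1]
  | succ m ih =>
    rw [pow_succ, ih, Finset.sum_mul]
    refine Finset.sum_congr rfl fun j _ => ?_
    rw [Finset.mul_sum, Finset.sum_eq_single (j + m)]
    · rw [mul_assoc, ← mul_assoc (v (j + m)), hv, if_pos rfl, hq]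
      push_cast
      rw [add_assoc]
    · intro l _ hl
      rw [mul_assoc, ← mul_assoc (v (j + m)), hv, if_neg hl.symm, zero_mul, mul_zero]
    · simp

/-- The `k`-th power shifts the index by `k`, which is zero in `ZMod k`. -/
theorem sum_star_mul_succ_pow_card (hv : ∀ j l, v j * star (v l) = if j = l then q else 0)
    (hq : ∀ j, q * v j = v j) (h1 : ∑ j, star (v j) * v j = 1) :
    (∑ j, star (v j) * v (j + 1)) ^ k = 1 := by
  rw [sum_star_mul_succ_pow hv hq h1]
  simpa using h1

theorem sum_star_mul_succ_mul_star (hv : ∀ j l, v j * star (v l) = if j = l then q else 0)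
    (hq : ∀ j, q * v j = v j) (h1 : ∑ j, star (v j) * v j = 1) :
    (∑ j, star (v j) * v (j + 1)) * star (∑ j, star (v j) * v (j + 1)) = 1 := by
  rw [star_sum, Finset.sum_mul, ← h1]
  refine Finset.sum_congr rfl fun j _ => ?_
  rw [Finset.mul_sum, Finset.sum_eq_single j]
  · rw [star_mul, star_star, mul_assoc, ← mul_assoc (v (j + 1)), hv, if_pos rfl, hq]
  · intro l _ hl
    rw [star_mul, star_star, mul_assoc, ← mul_assoc (v (j + 1)), hv,
      if_neg fun h => hl (add_right_cancel h).symm, zero_mul, mul_zero]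
  · simp

theorem star_sum_star_mul_succ_mul (hv : ∀ j l, v j * star (v l) = if j = l then q else 0)
    (hq : ∀ j, q * v j = v j) (h1 : ∑ j, star (v j) * v j = 1) :
    star (∑ j, star (v j) * v (j + 1)) * (∑ j, star (v j) * v (j + 1)) = 1 := by
  rw [star_sum, Finset.sum_mul, ← h1,
    ← Equiv.sum_comp (Equiv.addRight (1 : ZMod k)) fun j => star (v j) * v j]
  refine Finset.sum_congr rfl fun j _ => ?_
  rw [Finset.mul_sum, Finset.sum_eq_single j]
  · rw [star_mul, star_star, mul_assoc, ← mul_assoc (v j), hv, if_pos rfl, hq]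
    rfl
  · intro l _ hl
    rw [star_mul, star_star, mul_assoc, ← mul_assoc (v j), hv,
      if_neg hl.symm, zero_mul, mul_zero]
  · simp

end MatrixUnits

namespace GraphCStar

section CycleUnitary

variable (n : ℕ) [NeZero n]

local notation "𝐏" => CuntzKriegerFamily.P (gen (cycleGraph n))
local notation "𝐒" => CuntzKriegerFamily.S (gen (cycleGraph n))

theorem cycle_S_mul_star_S (i : Fin n) : 𝐒 i * star (𝐒 i) = 𝐏 i := by
  have hfin : ((cycleGraph n).s ⁻¹' {i}).Finite := Set.toFinite _
  have h := (gen (cycleGraph n)).sum_ranges i hfin ⟨i, rfl⟩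
  have h1 : hfin.toFinset = {i} := by ext; simp [cycleGraph]
  rw [h1, Finset.sum_singleton] at h
  exact h.symm

theorem cycle_P_mul_P (i j : Fin n) : 𝐏 i * 𝐏 j = if i = j then 𝐏 i else 0 := by
  split_ifs with h
  · rw [← h]; exact ((gen (cycleGraph n)).isProj i).isIdempotentElem
  · exact (gen (cycleGraph n)).orthogonal i j h

theorem cycle_P_mul_S (i j : Fin n) : 𝐏 j * 𝐒 i = if i = j then 𝐒 i else 0 := by
  have h : 𝐏 i * 𝐒 i = 𝐒 i := (gen (cycleGraph n)).P_mul_S i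
  rw [← h, ← mul_assoc, cycle_P_mul_P]
  split_ifs with h1 h2 h2
  · rw [h1]
  · exact absurd h1.symm h2
  · exact absurd h2.symm h1
  · rw [zero_mul]

theorem cycle_S_mul_P (i j : Fin n) : 𝐒 i * 𝐏 j = if i + 1 = j then 𝐒 i else 0 := by
  have h : 𝐒 i * 𝐏 (i + 1) = 𝐒 i := (gen (cycleGraph n)).S_mul_P i
  rw [← h, mul_assoc, cycle_P_mul_P]
  split_ifs
  · rfl
  · rw [mul_zero]

theorem cycle_star_P (i : Fin n) : star (𝐏 i) = 𝐏 i :=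
  ((gen (cycleGraph n)).isProj i).isSelfAdjoint

/-- The sum of all edges of a cycle, a unitary. -/
def cycleUnitary : GraphCStar (cycleGraph n) := ∑ i, 𝐒 i

theorem cycleUnitary_mul_star : cycleUnitary n * star (cycleUnitary n) = 1 := by
  rw [cycleUnitary, star_sum, Finset.sum_mul, one_eq]
  refine Finset.sum_congr rfl fun i _ => ?_
  rw [Finset.mul_sum, Finset.sum_eq_single i, cycle_S_mul_star_S]
  · intro j _ hj
    have h1 : 𝐒 i * 𝐏 (i + 1) = 𝐒 i := (gen (cycleGraph n)).S_mul_P i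
    have h2 : 𝐒 j * 𝐏 (i + 1) = 0 := by
      rw [cycle_S_mul_P, if_neg fun h => hj (add_right_cancel h)]
    have h3 := congrArg star h2
    rw [star_mul, star_zero, cycle_star_P] at h3
    rw [← h1, mul_assoc, h3, mul_zero]
  · simp

theorem star_cycleUnitary_mul : star (cycleUnitary n) * cycleUnitary n = 1 := by
  rw [cycleUnitary, star_sum, Finset.sum_mul, one_eq,
    -- The initial projection of the edge `i` is the vertex `i + 1`, hence the shift of the index.
    ← Equiv.sum_comp (Equiv.addRight (1 : Fin n)) fun i => 𝐏 i]
  refine Finset.sum_congr rfl fun i _ => ?_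
  rw [Finset.mul_sum, Finset.sum_eq_single i]
  · exact (gen (cycleGraph n)).star_S_mul_S i
  · intro j _ hj
    have h1 : 𝐏 j * 𝐒 j = 𝐒 j := (gen (cycleGraph n)).P_mul_S j
    have h2 : 𝐏 j * 𝐒 i = 0 := by rw [cycle_P_mul_S, if_neg hj.symm]
    have h3 := congrArg star h2
    rw [star_mul, star_zero, cycle_star_P] at h3
    rw [← h1, ← mul_assoc, h3, zero_mul]
  · simp

theorem gauge_cycleUnitary (z : Circle) :
    gauge _ z (cycleUnitary n) = (z : ℂ) • cycleUnitary n := by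
  rw [cycleUnitary, map_sum, Finset.smul_sum]
  exact Finset.sum_congr rfl fun i _ => gauge_S z i

/-! ### Vertex classes modulo `k` -/

variable (k : ℕ)

/-- The sum of the vertices of a cycle in a given class modulo `k`. -/
def cycleClass (c : ZMod k) : GraphCStar (cycleGraph n) :=
  ∑ i : Fin n, if ((i : ℕ) : ZMod k) = c then 𝐏 i else 0

theorem star_cycleClass (c : ZMod k) : star (cycleClass n k c) = cycleClass n k c := by
  rw [cycleClass, star_sum]
  refine Finset.sum_congr rfl fun i _ => ?_
  split_ifs
  · exact cycle_star_P n i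
  · exact star_zero _

theorem gauge_cycleClass (z : Circle) (c : ZMod k) :
    gauge _ z (cycleClass n k c) = cycleClass n k c := by
  rw [cycleClass, map_sum]
  refine Finset.sum_congr rfl fun i _ => ?_
  split_ifs
  · exact gauge_P z i
  · exact map_zero _

theorem cycleClass_mul_cycleClass (c d : ZMod k) :
    cycleClass n k c * cycleClass n k d = if c = d then cycleClass n k c else 0 := by
  have h : ∀ i : Fin n, 𝐏 i * cycleClass n k d = if ((i : ℕ) : ZMod k) = d then 𝐏 i else 0 := by
    intro i
    rw [cycleClass, Finset.mul_sum, Finset.sum_eq_single i]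
    · simp [cycle_P_mul_P]
    · intro j _ hj
      simp [cycle_P_mul_P, hj.symm]
    · simp
  conv_lhs => rw [cycleClass]
  rw [Finset.sum_mul]
  simp only [ite_mul, zero_mul, h]
  split_ifs with hcd
  · rw [cycleClass, hcd]
    refine Finset.sum_congr rfl fun i _ => ?_
    split_ifs <;> rfl
  · refine Finset.sum_eq_zero fun i _ => ?_
    split_ifs with h1 h2
    · exact absurd (h1.symm.trans h2) hcd
    · rfl
    · rfl

theorem sum_cycleClass [NeZero k] : ∑ c, cycleClass n k c = 1 := by
  simp only [cycleClass]
  rw [Finset.sum_comm, one_eq]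
  simp

variable {n k}

/-- Addition in `Fin n` is reduced modulo `n`, which is invisible modulo a divisor `k`. The
construction of the unitary of order `k` uses the divisibility only through this fact. -/
theorem Fin.natCast_val_add_one_of_dvd (h : k ∣ n) (i : Fin n) :
    (((i + 1 : Fin n) : ℕ) : ZMod k) = (i : ℕ) + 1 := by
  rw [Fin.val_add, ← Nat.cast_one, ← Nat.cast_add, ZMod.natCast_eq_natCast_iff]
  refine ((Nat.mod_modEq _ n).of_dvd h).trans (Nat.ModEq.add_left _ ?_)
  -- The value of `1` in `Fin n` is `1 % n`, which is `0` for the single loop.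
  rw [Fin.val_one']
  exact (Nat.mod_modEq _ n).of_dvd h

theorem cycleUnitary_mul_cycleClass (h : k ∣ n) (c : ZMod k) :
    cycleUnitary n * cycleClass n k (c + 1) = cycleClass n k c * cycleUnitary n := by
  have h1 : ∀ i : Fin n, 𝐒 i * cycleClass n k (c + 1) =
      if ((i : ℕ) : ZMod k) = c then 𝐒 i else 0 := by
    intro i
    rw [cycleClass, Finset.mul_sum, Finset.sum_eq_single (i + 1)]
    · simp [cycle_S_mul_P, Fin.natCast_val_add_one_of_dvd h]
    · intro j _ hj
      simp [cycle_S_mul_P, hj.symm]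
    · simp
  have h2 : ∀ i : Fin n, cycleClass n k c * 𝐒 i =
      if ((i : ℕ) : ZMod k) = c then 𝐒 i else 0 := by
    intro i
    rw [cycleClass, Finset.sum_mul, Finset.sum_eq_single i]
    · simp [cycle_P_mul_S]
    · intro j _ hj
      simp [cycle_P_mul_S, hj.symm]
    · simp
  rw [cycleUnitary, Finset.sum_mul, Finset.mul_sum]
  exact Finset.sum_congr rfl fun i _ => (h1 i).trans (h2 i).symm

theorem cycleClass_mul_cycleUnitary_pow (h : k ∣ n) (c : ZMod k) (m : ℕ) :
    cycleClass n k c * cycleUnitary n ^ m = cycleUnitary n ^ m * cycleClass n k (c + m) := by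
  induction m with
  | zero => simp
  | succ m ih =>
    rw [pow_succ, ← mul_assoc, ih, mul_assoc, ← cycleUnitary_mul_cycleClass h, ← mul_assoc]
    push_cast
    rw [add_assoc]

theorem cycleUnitary_pow_mul_star (n m : ℕ) [NeZero n] :
    cycleUnitary n ^ m * star (cycleUnitary n ^ m) = 1 := by
  rw [star_pow]
  exact (pow_mul_pow_eq_one m (cycleUnitary_mul_star n) :)

theorem star_cycleUnitary_pow_mul (n m : ℕ) [NeZero n] :
    star (cycleUnitary n ^ m) * cycleUnitary n ^ m = 1 := by
  rw [star_pow]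
  exact (pow_mul_pow_eq_one m (star_cycleUnitary_mul n) :)

/-- If `k` divides `n`, there is a unitary of order `k` on which the gauge action is by scalars. -/
theorem exists_unitary_pow_eq_one [NeZero k] (h : k ∣ n) :
    ∃ u : GraphCStar (cycleGraph n), u * star u = 1 ∧ star u * u = 1 ∧ u ^ k = 1 ∧
      ∀ g, cyclicGauge (cycleGraph n) k g u = (ZMod.toCircle g.toAdd : ℂ) • u := by
  -- With `Q c` the class projections and `U` the edge unitary, `v j` is a partial isometry from `Q
  -- j` onto `Q 0`. In the resulting unitary the term at `j` is `Q j * U`, except at the wraparound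
  -- `j = k - 1`, where it is `Q j` times the inverse of `U ^ (k - 1)`.
  let v : ZMod k → GraphCStar (cycleGraph n) := fun j => cycleClass n k 0 * cycleUnitary n ^ j.val
  have hv' : ∀ j, v j = cycleUnitary n ^ j.val * cycleClass n k j := fun j => by
    simp [v, cycleClass_mul_cycleUnitary_pow h]
  have hidem : ∀ c, cycleClass n k c * cycleClass n k c = cycleClass n k c := fun c => by
    simp [cycleClass_mul_cycleClass]
  have hv : ∀ j l, v j * star (v l) = if j = l then cycleClass n k 0 else 0 := by
    intro j l
    have h1 : v j * star (v l) = cycleUnitary n ^ j.val * (cycleClass n k j * cycleClass n k l) *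
        star (cycleUnitary n ^ l.val) := by
      rw [hv', hv', star_mul, star_cycleClass]
      simp only [mul_assoc]
    rw [h1, cycleClass_mul_cycleClass]
    split_ifs with hjl
    · subst hjl
      have h2 := cycleClass_mul_cycleUnitary_pow h (0 : ZMod k) j.val
      rw [zero_add, ZMod.natCast_zmod_val] at h2
      rw [← h2, mul_assoc, cycleUnitary_pow_mul_star, mul_one]
    · rw [mul_zero, zero_mul]
  have hq : ∀ j, cycleClass n k 0 * v j = v j := fun j => by
    simp only [v]
    rw [← mul_assoc, hidem]
  have h1 : ∑ j, star (v j) * v j = 1 := by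
    rw [← sum_cycleClass n k]
    refine Finset.sum_congr rfl fun j _ => ?_
    rw [hv', star_mul, star_cycleClass, mul_assoc, ← mul_assoc (star _),
      star_cycleUnitary_pow_mul, one_mul, hidem]
  refine ⟨_, sum_star_mul_succ_mul_star hv hq h1, star_sum_star_mul_succ_mul hv hq h1,
    sum_star_mul_succ_pow_card hv hq h1, fun g => ?_⟩
  have hg : ∀ j, cyclicGauge (cycleGraph n) k g (v j) =
      (ZMod.toCircle (j * g.toAdd) : ℂ) • v j := fun j => by
    change gauge _ (ZMod.toCircle g.toAdd) (cycleClass n k 0 * cycleUnitary n ^ j.val) = _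
    rw [map_mul, map_pow, gauge_cycleClass, gauge_cycleUnitary, smul_pow, mul_smul_comm]
    -- The scalar on `v j` depends only on the class of `j`, since it is a power of a `k`-th root of
    -- unity; the wraparound term therefore scales like the others.
    congr 1
    conv_rhs => rw [← ZMod.natCast_zmod_val j, ← nsmul_eq_mul, AddChar.map_nsmul_eq_pow]
    simp
  rw [map_sum, Finset.smul_sum]
  refine Finset.sum_congr rfl fun j _ => ?_
  rw [map_mul, map_star, hg, hg, star_smul, smul_mul_smul_comm]
  congr 1
  rw [add_mul, one_mul, AddChar.map_add_eq_mul, Circle.coe_mul, ← mul_assoc]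
  have : star (ZMod.toCircle (j * g.toAdd) : ℂ) * (ZMod.toCircle (j * g.toAdd) : ℂ) = 1 := by
    simp [← Complex.normSq_eq_conj_mul_self]
  rw [this, one_mul]

end CycleUnitary

end GraphCStar

/-! ## The circle and the join -/

/-- The path in the join `Y * Y` that runs through the edges joining consecutive members of a
sequence of points, with `c m` in the first copy at `m` and in the second copy at `m + 1/2`. -/
def TopJoin.zigzag {Y : Type u} (c : ℤ → Y) (x : ℝ) : TopJoin Y Y :=
  Quot.mk _ (c (round x), c ⌊x⌋, Set.projIcc 0 1 zero_le_one (2 * |x - round x|))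

namespace TopJoin

variable {Y : Type u} (c : ℤ → Y)

/-- On this interval `round` jumps only at the right endpoint, where the join parameter is `1` and
the first coordinate is forgotten. -/
theorem zigzag_eq_of_mem_left {a : ℤ} {x : ℝ} (h : x ∈ Set.Icc (a : ℝ) (a + 1 / 2)) :
    zigzag c x = Quot.mk _ (c a, c a, Set.projIcc 0 1 zero_le_one (2 * (x - a))) := by
  have hf : ⌊x⌋ = a := Int.floor_eq_iff.2 ⟨h.1, by linarith [h.2]⟩
  rcases h.2.lt_or_eq with h2 | h2
  · have hr : round x = a := by
      rw [round_eq, Int.floor_eq_iff]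
      constructor <;> linarith [h.1]
    rw [zigzag, hf, hr, abs_of_nonneg (by linarith [h.1])]
  · have hr : round x = a + 1 := by
      rw [round_eq, Int.floor_eq_iff]
      push_cast
      constructor <;> linarith
    have h3 : 2 * |x - round x| = 1 := by
      rw [hr, abs_of_nonpos] <;> push_cast <;> linarith
    have h4 : 2 * (x - a) = 1 := by linarith
    rw [zigzag, hf, h3, h4, Set.projIcc_right]
    exact Quot.sound (.one _ _ _)

/-- Here the floor jumps only at the right endpoint, where the join parameter is `0` and the second
coordinate is forgotten. -/
theorem zigzag_eq_of_mem_right {a : ℤ} {x : ℝ} (h : x ∈ Set.Icc ((a : ℝ) + 1 / 2) (a + 1)) :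
    zigzag c x = Quot.mk _ (c (a + 1), c a, Set.projIcc 0 1 zero_le_one (2 * (a + 1 - x))) := by
  have hr : round x = a + 1 := by
    rw [round_eq, Int.floor_eq_iff]
    push_cast
    constructor <;> linarith [h.1, h.2]
  have h3 : 2 * |x - round x| = 2 * (a + 1 - x) := by
    rw [hr, abs_of_nonpos] <;> push_cast <;> linarith [h.2]
  rw [zigzag, h3, hr]
  rcases h.2.lt_or_eq with h2 | h2
  · have hf : ⌊x⌋ = a := Int.floor_eq_iff.2 ⟨by linarith [h.1], h2⟩
    rw [hf]
  · have h4 : 2 * (a + 1 - x) = 0 := by linarith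
    rw [h4, Set.projIcc_left]
    exact Quot.sound (.zero _ _ _)

theorem continuous_zigzag [TopologicalSpace Y] : Continuous (zigzag c) := by
  have hlf : LocallyFinite fun a : ℤ => Set.Icc (a : ℝ) (a + 1) :=
    locallyFinite_Icc_of_tendsto tendsto_intCast_atTop_atTop
      (Filter.tendsto_atBot_add_const_right _ _ (tendsto_intCast_atBot_iff.2 Filter.tendsto_id))
  refine hlf.continuous ?_ (fun a => isClosed_Icc) fun a => ?_
  · exact Set.eq_univ_of_forall fun x =>
      Set.mem_iUnion.2 ⟨⌊x⌋, Int.floor_le x, (Int.lt_floor_add_one x).le⟩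
  · have h : Set.Icc (a : ℝ) (a + 1) =
        Set.Icc (a : ℝ) (a + 1 / 2) ∪ Set.Icc ((a : ℝ) + 1 / 2) (a + 1) :=
      (Set.Icc_union_Icc_eq_Icc (by linarith) (by linarith)).symm
    rw [h]
    refine ContinuousOn.union_of_isClosed ?_ ?_ isClosed_Icc isClosed_Icc
    · refine ContinuousOn.congr (Continuous.continuousOn ?_) fun x hx => zigzag_eq_of_mem_left c hx
      exact continuous_quot_mk.comp (by fun_prop)
    · refine ContinuousOn.congr (Continuous.continuousOn ?_) fun x hx => zigzag_eq_of_mem_right c hx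
      exact continuous_quot_mk.comp (by fun_prop)

end TopJoin

section CircleToJoin

variable (k : ℕ)

/-- The zigzag path through the integers modulo `k`. -/
def zigzagZMod (x : ℝ) : (RightGSpace.EG (Multiplicative (ZMod k)) 1).carrier :=
  TopJoin.zigzag (fun m : ℤ => Multiplicative.ofAdd (m : ZMod k)) x

/-- Rounding and floor commute with integer shifts, and the distance to the nearest integer is
unchanged. The case `m = k` makes the path periodic, so that it descends to the circle. -/
theorem zigzagZMod_add_intCast (x : ℝ) (m : ℤ) : zigzagZMod k (x + m) =
    (RightGSpace.EG (Multiplicative (ZMod k)) 1).act (Multiplicative.ofAdd (m : ZMod k))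
      (zigzagZMod k x) := by
  refine congrArg (Quot.mk _) ?_
  have h : x + m - (round x + m : ℤ) = x - round x := by push_cast; ring
  rw [round_add_intCast, Int.floor_add_intCast, h]
  simp only [Int.cast_add]
  rfl

theorem periodic_zigzagZMod : Function.Periodic (zigzagZMod k) (k : ℝ) := fun x => by
  have h := zigzagZMod_add_intCast k x k
  rw [Int.cast_natCast, Int.cast_natCast, ZMod.natCast_self, ofAdd_zero,
    RightGSpace.act_one] at h
  exact h

theorem continuous_lift_zigzagZMod : Continuous (periodic_zigzagZMod k).lift :=
  continuous_coinduced_dom.2 (TopJoin.continuous_zigzag _)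

variable [NeZero k]

/-- An equivariant map from the circle to the join of two copies of the integers modulo `k`. -/
def circleToJoin : C(Circle, (RightGSpace.EG (Multiplicative (ZMod k)) 1).carrier) where
  toFun z := (periodic_zigzagZMod k).lift
    ((AddCircle.homeomorphCircle (Nat.cast_ne_zero.2 (NeZero.ne k) : (k : ℝ) ≠ 0)).symm z)
  continuous_toFun := (continuous_lift_zigzagZMod k).comp (Homeomorph.continuous _)

theorem circleToJoin_toCircle (x : ℝ) :
    circleToJoin k (AddCircle.toCircle (x : AddCircle (k : ℝ))) = zigzagZMod k x := by
  have hk : (k : ℝ) ≠ 0 := Nat.cast_ne_zero.2 (NeZero.ne k)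
  rw [← AddCircle.homeomorphCircle_apply hk]
  change (periodic_zigzagZMod k).lift ((AddCircle.homeomorphCircle hk).symm _) = _
  rw [Homeomorph.symm_apply_apply]
  rfl

theorem circleToJoin_toCircle_mul (g : Multiplicative (ZMod k)) (z : Circle) :
    circleToJoin k (ZMod.toCircle g.toAdd * z) =
      (RightGSpace.EG (Multiplicative (ZMod k)) 1).act g (circleToJoin k z) := by
  have hk : (k : ℝ) ≠ 0 := Nat.cast_ne_zero.2 (NeZero.ne k)
  obtain ⟨y, rfl⟩ := (AddCircle.homeomorphCircle hk).surjective z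
  obtain ⟨x, rfl⟩ := QuotientAddGroup.mk_surjective y
  -- On the circle `ℝ / kℤ`, multiplication by the root of unity of the class of `m` is the shift by
  -- `m`.
  obtain ⟨m, hm⟩ := ZMod.intCast_surjective g.toAdd
  have h1 : ZMod.toCircle g.toAdd = AddCircle.toCircle ((m : ℝ) : AddCircle (k : ℝ)) := by
    rw [← hm, AddCircle.toCircle_apply_mk]
    ext
    rw [ZMod.toCircle_intCast, Circle.coe_exp]
    push_cast
    ring_nf
  have h2 : g = Multiplicative.ofAdd (m : ZMod k) := by rw [hm]; rfl
  rw [AddCircle.homeomorphCircle_apply, h1, ← AddCircle.toCircle_add, ← QuotientAddGroup.mk_add,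
    circleToJoin_toCircle, circleToJoin_toCircle, add_comm, zigzagZMod_add_intCast, h2]

end CircleToJoin

/-! ### Assembling the bounds for the cycle -/

namespace GraphCStar

open LocalTriviality

variable (n k : ℕ) [NeZero n] [NeZero k]

theorem exists_equivariant_join : ∃ φ : C((RightGSpace.EG (Multiplicative (ZMod k)) 1).carrier, ℂ)
      →⋆ₐ[ℂ] GraphCStar (cycleGraph n),
    ∀ g f, φ (f.comp ((RightGSpace.EG _ 1).act g)) = cyclicGauge (cycleGraph n) k g (φ f) := by
  have hu : cycleUnitary n ∈ unitary (GraphCStar (cycleGraph n)) :=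
    ⟨star_cycleUnitary_mul n, cycleUnitary_mul_star n⟩
  have hN : IsStarNormal (cycleUnitary n) := ⟨hu.1.trans hu.2.symm⟩
  let toC : C(Metric.sphere (0 : ℂ) 1, Circle) :=
    ⟨fun z => ⟨z, z.2⟩, by fun_prop⟩
  refine exists_equivariant_starAlgHom _ _ (fun g => (ZMod.toCircle g.toAdd : ℂ)) (cycleUnitary n)
    (fun g => gauge_cycleUnitary n _) (Metric.sphere (0 : ℂ) 1)
    (spectrum.subset_circle_of_unitary hu) ((circleToJoin k).comp toC)
    (fun g => ⟨fun z => ⟨ZMod.toCircle g.toAdd * z, by simp [Circle.norm_coe]⟩, by fun_prop⟩) (fun _ _ => rfl)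
    fun g z => ?_
  exact (congrArg (circleToJoin k) (Subtype.ext rfl)).trans
    (circleToJoin_toCircle_mul k g (toC z))

theorem exists_equivariant_self (h : k ∣ n) :
    ∃ φ : C((RightGSpace.EG (Multiplicative (ZMod k)) 0).carrier, ℂ)
      →⋆ₐ[ℂ] GraphCStar (cycleGraph n),
    ∀ g f, φ (f.comp ((RightGSpace.EG _ 0).act g)) = cyclicGauge (cycleGraph n) k g (φ f) := by
  obtain ⟨u, h1, h2, hk, hg⟩ := exists_unitary_pow_eq_one (n := n) h
  have hN : IsStarNormal u := ⟨h2.trans h1.symm⟩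
  let χ : Multiplicative (ZMod k) → ℂ := fun g => ZMod.toCircle g.toAdd
  have hinj : Function.Injective χ := fun a b hab => by
    simpa using ZMod.injective_toCircle (Subtype.ext hab)
  have hfin : Finite (Set.range χ) := Set.finite_range χ
  have hmul : ∀ a b, χ (a * b) = χ a * χ b := fun a b => by
    simp [χ, AddChar.map_add_eq_mul]
  -- Since `u ^ k = 1`, every `z` in the spectrum has `z ^ k` in the spectrum of `1`, so `z` is a
  -- `k`-th root of unity.
  have hsp : spectrum ℂ u ⊆ Set.range χ := by
    intro z hz
    have h3 := spectrum.pow_mem_pow u k hz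
    rw [hk] at h3
    have hz1 : z ^ k = 1 := by
      by_contra hne
      refine h3 ?_
      have := (IsUnit.mk0 _ (sub_ne_zero.2 hne)).map
        (algebraMap ℂ (GraphCStar (cycleGraph n)))
      rwa [map_sub, map_one] at this
    obtain ⟨i, _, hi⟩ := (Complex.isPrimitiveRoot_exp k (NeZero.ne k)).eq_pow_of_pow_eq_one hz1
    refine ⟨Multiplicative.ofAdd (i : ZMod k), ?_⟩
    simp only [χ, toAdd_ofAdd]
    rw [ZMod.toCircle_natCast, ← hi, ← Complex.exp_nat_mul]
    congr 1
    ring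
  let e := Equiv.ofInjective χ hinj
  have he : ∀ g, (e g : ℂ) = χ g := fun _ => rfl
  refine exists_equivariant_starAlgHom _ _ χ u hg (Set.range χ) hsp
    ⟨fun x => e.symm x, continuous_of_discreteTopology⟩
    (fun g => ⟨fun x => ⟨χ g * x, by
      obtain ⟨_, a, rfl⟩ := x
      exact ⟨g * a, hmul g a⟩⟩, continuous_of_discreteTopology⟩) (fun _ _ => rfl) fun g x => ?_
  obtain ⟨a, rfl⟩ := e.surjective x
  change e.symm _ = e.symm (e a) * g
  rw [Equiv.symm_apply_apply, Equiv.symm_apply_eq]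
  refine Subtype.ext ?_
  rw [he, mul_comm a, hmul]
  rfl

theorem not_isUnit_of_not_dvd (h : ¬ k ∣ n)
    (ρ : ConeAlgebra (Multiplicative (ZMod k)) →⋆ₙₐ[ℂ] GraphCStar (cycleGraph n))
    (hρ : IsEquivariant (cyclicGauge (cycleGraph n) k) ρ) :
    ¬ IsUnit (ρ (tOne (Multiplicative (ZMod k)))) := fun hu => by
  obtain ⟨p, hp, hsum⟩ := exists_isIdempotentElem_sum_eq_one _ ρ hρ hu
  exact h (dvd_of_sum_cyclicGauge_eq_one n k hp hsum)

end GraphCStar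

end

theorem mainTheorem12 (n k : ℕ) [NeZero n] [NeZero k] (hk : 2 ≤ k) :
    (k ∣ n →
      LocalTriviality.weakTrivDim (GraphCStar.cyclicGauge (cycleGraph n) k) = 0 ∧
      LocalTriviality.trivDim (GraphCStar.cyclicGauge (cycleGraph n) k) = 0 ∧
      LocalTriviality.strongTrivDim (GraphCStar.cyclicGauge (cycleGraph n) k) = 0) ∧
    (¬ k ∣ n →
      LocalTriviality.weakTrivDim (GraphCStar.cyclicGauge (cycleGraph n) k) = 1 ∧
      LocalTriviality.trivDim (GraphCStar.cyclicGauge (cycleGraph n) k) = 1 ∧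
      LocalTriviality.strongTrivDim (GraphCStar.cyclicGauge (cycleGraph n) k) = 1) :=
  ⟨fun h => LocalTriviality.all_trivDim_eq_zero _ (GraphCStar.exists_equivariant_self n k h),
    fun h => LocalTriviality.all_trivDim_eq_one _ (GraphCStar.not_isUnit_of_not_dvd n k h)
      (GraphCStar.exists_equivariant_join n k)⟩
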